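/- Let $T\in(0,\infty)$, let $(\Omega,\mathcal F,\mathbb P)$ be a complete probability space carrying two independent standard one-dimensional Brownian motions $W,\overline W$ and a homogeneous càdlàg Markov chain $\alpha$ with values in $\mathcal S=\{1,\dots,D\}$ and generator $\Lambda=(\lambda_{ij})$, where $\lambda_{ij}>0$ for $i\ne j$ and $\sum_j\lambda_{ij}=0$; $\alpha$ is independent of $(W,\overline W)$, and $\alpha(0)=i$ a.s. for a given $i\in\mathcal S$. Let $\mathbb F$ be the filtration generated by $W,\overline W,\alpha$ and $\mathbb G$ the filtration generated by $W,\alpha$, both augmented by the $\mathbb P$-null sets. For a filtration $\mathbb H$, $L^2_{\mathbb H}(0,T;\mathbb R^k)$ is the set of $\mathbb H$-progressively measurable $\phi:[0,T]\times\Omega\to\mathbb R^k$ with $\mathbb E\int_0^T|\phi(s)|^2ds<\infty$. Consider deterministic coefficients of appropriate dimensions, depending on $(s,j)\in[0,T]\times\mathcal S$, and put $B=(B_1\ B_2)$, $D=(D_1\ D_2)$, $\bar D=(\bar D_1\ \bar D_2)$, $R=\mathrm{diag}(R_1,R_2)$, $S=\binom{S_1}{S_2}$, $\rho=\binom{\rho_1}{\rho_2}$.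 Assume for each $j\in\mathcal S$: (H1) $A(\cdot,j),b(\cdot,j)\in L^1(0,T)$; $B(\cdot,j),C(\cdot,j),\bar C(\cdot,j),\sigma(\cdot,j),\bar\sigma(\cdot,j)\in L^2(0,T)$; $D(\cdot,j),\bar D(\cdot,j)\in L^\infty(0,T)$. (H2) $Q(\cdot,j)\in L^1(0,T)$ and $R(\cdot,j)\in L^\infty(0,T)$ are symmetric-matrix valued; $S(\cdot,j),\rho(\cdot,j)\in L^2(0,T)$; $q(\cdot,j)\in L^1(0,T)$; $G(T,j)\in\mathbb R^{n\times n}$ is symmetric and $g(T,j)\in\mathbb R^n$. (H3) $G(T,j)\ge0$, and for a.e. $s\in[0,T]$: $R(s,j)\ge\delta I$ for some $\delta>0$, and $Q(s,j)-S(s,j)^\top R(s,j)^{-1}S(s,j)\ge0$. Here $b,\sigma,\bar\sigma,q,\rho,g$ are the non-homogeneous terms of the general problem; the quantities below are those of the homogeneous problem, in which these terms are replaced by $0$. For $u\in L^2_{\mathbb G}(0,T;\mathbb R^m)$ and $v\in L^2_{\mathbb F}(0,T;\mathbb R^{n_v})$ let $x^0$ be the strong solution, in the space of continuous $\mathbb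 F$-adapted processes with $\mathbb E\sup_{s\in[0,T]}|x^0(s)|^2<\infty$, of $$dx^0=[Ax^0+B_1u+B_2v]\,ds+[Cx^0+D_1u+D_2v]\,dW+[\bar Cx^0+\bar D_1u+\bar D_2v]\,d\overline W,\qquad x^0(0)=0,$$ where all coefficients are evaluated at $(s,\alpha(s))$. For $\gamma>0$ put $$J^0_\gamma(0,0,i;u,v)=\mathbb E\Big\{\langle G(T,\alpha(T))x^0(T),x^0(T)\rangle+\int_0^T\big[\langle Qx^0,x^0\rangle+\langle R_1u,u\rangle+\langle(R_2-\gamma^2I)v,v\rangle+2\langle S_1x^0,u\rangle+2\langle S_2x^0,v\rangle\big]ds\Big\},$$ $$\overline V^0_\gamma(0,0,i)=\inf_{u\in L^2_{\mathbb G}(0,T;\mathbb R^m)}\ \sup_{v\in L^2_{\mathbb F}(0,T;\mathbb R^{n_v})}J^0_\gamma(0,0,i;u,v)\in[-\infty,\infty],$$ $$\bar\Gamma=\{\gamma>0:\ \overline V^0_{\gamma'}(0,0,i)=0\ \text{ for all }\gamma'>\gamma\},\qquad \bar\gamma=\inf\bar\Gamma\quad(\inf\emptyset=+\infty).$$ Then: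 if $\gamma>0$ satisfies $\overline V^0_\gamma(0,0,i)=0$, then $\gamma\ge\bar\gamma$. -/

import Mathlib

open MeasureTheory ProbabilityTheory Filter Topology Matrix Set
open scoped NNReal ENNReal

noncomputable section

namespace RegimeLQ

/-- Lebesgue measure on `[0,∞)`. -/
def leb : Measure ℝ≥0 := (volume : Measure ℝ).comap ((↑) : ℝ≥0 → ℝ)

/-- The σ-algebra `σ {X r ; 0 ≤ r ≤ s}`. -/
@[reducible]
def pastSigma {Ω E : Type*} [MeasurableSpace E] (X : ℝ≥0 → Ω → E) (s : ℝ≥0) :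
    MeasurableSpace Ω :=
  ⨆ r : ℝ≥0, ⨆ _ : r ≤ s, MeasurableSpace.comap (X r) inferInstance

/-- The probabilistic basis: two Brownian motions `W`, `Wbar` and a continuous-time Markov chain
`α` with finite state space `Fin d` and generator `Λ`, all independent. -/
structure Basis {Ω : Type*} [MeasurableSpace Ω] (P : Measure Ω) (d : ℕ) where
  W : ℝ≥0 → Ω → ℝ
  Wbar : ℝ≥0 → Ω → ℝ
  α : ℝ≥0 → Ω → Fin d
  /-- the generator of the chain -/
  Λ : Matrix (Fin d) (Fin d) ℝ
  measurable_W : ∀ s, Measurable (W s)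
  measurable_Wbar : ∀ s, Measurable (Wbar s)
  measurable_α : ∀ s, Measurable (α s)
  brownian_W : IsBrownianReal W P
  brownian_Wbar : IsBrownianReal Wbar P
  indep_W_Wbar : IndepFun (fun ω s => W s ω) (fun ω s => Wbar s ω) P
  indep_WWbar_α : IndepFun (fun ω s => (W s ω, Wbar s ω)) (fun ω s => α s ω) P
  rate_pos : ∀ i j, i ≠ j → 0 < Λ i j
  rate_sum : ∀ i, ∑ j, Λ i j = 0
  /-- the paths of the chain are right-continuous ... -/
  rightCont : ∀ ω s, ∀ᶠ r in 𝓝[>] s, α r ω = α s ω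
  /-- ... with left limits (in the discrete space `Fin d`) -/
  leftLim : ∀ ω s, ∃ j, ∀ᶠ r in 𝓝[<] s, α r ω = j
  /-- homogeneous Markov property with transition matrices `exp ((t - s) Λ)` -/
  markov : ∀ s t : ℝ≥0, s ≤ t → ∀ j,
    P[(α t ⁻¹' {j}).indicator (fun _ => (1 : ℝ)) | pastSigma α s]
      =ᵐ[P] fun ω => (NormedSpace.exp (((t : ℝ) - (s : ℝ)) • Λ)) (α s ω) j

section Filtrations

variable {Ω : Type*} [mΩ : MeasurableSpace Ω] {P : Measure Ω} {d : ℕ}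

/-- The σ-algebra generated by the `P`-null sets. -/
@[reducible]
def nullSigma (P : Measure Ω) : MeasurableSpace Ω :=
  MeasurableSpace.generateFrom {N | MeasurableSet N ∧ P N = 0}

theorem nullSigma_le (P : Measure Ω) : nullSigma P ≤ mΩ :=
  MeasurableSpace.generateFrom_le fun _ h => h.1

theorem pastSigma_mono {Ω E : Type*} [MeasurableSpace E] (X : ℝ≥0 → Ω → E) {s t : ℝ≥0}
    (h : s ≤ t) : pastSigma X s ≤ pastSigma X t :=
  iSup₂_le fun r hr => le_iSup₂_of_le r (hr.trans h) le_rfl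

theorem pastSigma_le {E : Type*} [MeasurableSpace E] {X : ℝ≥0 → Ω → E}
    (hX : ∀ s, Measurable (X s)) (s : ℝ≥0) : pastSigma X s ≤ mΩ :=
  iSup₂_le fun r _ => (hX r).comap_le

/-- The full information `𝔽`: generated by `W`, `Wbar`, `α` and the null sets. -/
def Basis.F (𝔹 : Basis P d) : Filtration ℝ≥0 mΩ where
  seq s := pastSigma 𝔹.W s ⊔ pastSigma 𝔹.Wbar s ⊔ pastSigma 𝔹.α s ⊔ nullSigma P
  mono' _ _ h := sup_le_sup (sup_le_sup (sup_le_sup (pastSigma_mono _ h) (pastSigma_mono _ h))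
    (pastSigma_mono _ h)) le_rfl
  le' s := sup_le (sup_le (sup_le (pastSigma_le 𝔹.measurable_W s)
    (pastSigma_le 𝔹.measurable_Wbar s)) (pastSigma_le 𝔹.measurable_α s)) (nullSigma_le P)

/-- The partial information `𝔾`: generated by `W`, `α` and the null sets. -/
def Basis.G (𝔹 : Basis P d) : Filtration ℝ≥0 mΩ where
  seq s := pastSigma 𝔹.W s ⊔ pastSigma 𝔹.α s ⊔ nullSigma P
  mono' _ _ h := sup_le_sup (sup_le_sup (pastSigma_mono _ h) (pastSigma_mono _ h)) le_rfl
  le' s := sup_le (sup_le (pastSigma_le 𝔹.measurable_W s)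
    (pastSigma_le 𝔹.measurable_α s)) (nullSigma_le P)

/-- The space `L²_H(t,T;ℝᵏ)` of processes on `[t,T]` that are progressively measurable with
respect to the filtration `H` and satisfy `E ∫_t^T |φ(s)|² ds < ∞`, where `|z|² = z ⬝ᵥ z` is the
Euclidean norm. A process on `[t,T]` is represented by any progressive extension of it to
`[0,∞)`, e.g. the one by `0`; the values outside `[t,T]` play no role in what follows. -/
def L2Prog (P : Measure Ω) (H : Filtration ℝ≥0 mΩ) (t T : ℝ≥0) (k : ℕ) :
    Set (ℝ≥0 → Ω → Fin k → ℝ) :=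
  {φ | IsProgressive H φ ∧
    ∫⁻ ω, ∫⁻ s in Icc t T, ENNReal.ofReal (φ s ω ⬝ᵥ φ s ω) ∂leb ∂P < ∞}

/-! ### The Itô integral of square-integrable integrands -/

/-- A simple process `∑_{k < N} ζ_k 1_{(τ_k, τ_{k+1}]}` on `(t,∞)`, with `ζ_k` bounded and
`H (τ_k)`-measurable. -/
structure SimpleProc (H : Filtration ℝ≥0 mΩ) (t : ℝ≥0) where
  N : ℕ
  τ : ℕ → ℝ≥0
  mono : Monotone τ
  start : t ≤ τ 0
  ζ : ℕ → Ω → ℝ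
  meas : ∀ k, Measurable[H (τ k)] (ζ k)
  bdd : ∀ k, ∃ c : ℝ, ∀ ω, |ζ k ω| ≤ c

/-- The value of a simple process. -/
def SimpleProc.eval {H : Filtration ℝ≥0 mΩ} {t : ℝ≥0} (φ : SimpleProc H t) (s : ℝ≥0) (ω : Ω) :
    ℝ :=
  ∑ k ∈ Finset.range φ.N, (Ioc (φ.τ k) (φ.τ (k + 1))).indicator (fun _ => φ.ζ k ω) s

/-- The elementary stochastic integral `∫_t^s φ dB` of a simple process. -/
def SimpleProc.integral {H : Filtration ℝ≥0 mΩ} {t : ℝ≥0} (φ : SimpleProc H t)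
    (B : ℝ≥0 → Ω → ℝ) (s : ℝ≥0) (ω : Ω) : ℝ :=
  ∑ k ∈ Finset.range φ.N, φ.ζ k ω * (B (min (φ.τ (k + 1)) s) ω - B (min (φ.τ k) s) ω)

/-- `I` is (a continuous adapted version of) the Itô integral process `s ↦ ∫_t^s f dB` on `[t,T]`:
the `L²`-limit of the elementary integrals of simple processes that converge to `f` in
`L²(Ω × [t,T])`. -/
structure IsItoIntegral (P : Measure Ω) (H : Filtration ℝ≥0 mΩ) (B : ℝ≥0 → Ω → ℝ) (t T : ℝ≥0)
    (f I : ℝ≥0 → Ω → ℝ) : Prop where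
  adapted : ∀ s ∈ Icc t T, Measurable[H s] (I s)
  continuousOn : ∀ ω, ContinuousOn (fun s => I s ω) (Icc t T)
  approx : ∃ φ : ℕ → SimpleProc H t,
    Tendsto (fun k => ∫⁻ ω, ∫⁻ s in Icc t T, ENNReal.ofReal (((φ k).eval s ω - f s ω) ^ 2) ∂leb ∂P)
      atTop (𝓝 0) ∧
    ∀ s ∈ Icc t T,
      Tendsto (fun k => ∫⁻ ω, ENNReal.ofReal (((φ k).integral B s ω - I s ω) ^ 2) ∂P)
        atTop (𝓝 0)

end Filtrations

/-! ### The coefficients -/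

/-- Coefficients of the state equation and of the cost functional; state in `ℝⁿ`, control in
`ℝᵐ`, disturbance in `ℝᵏ`, regimes in `Fin d`. `G j`, `g j` are the terminal weights
`G(T,j)`, `g(T,j)`. -/
structure Coeffs (n m k d : ℕ) where
  A : ℝ≥0 → Fin d → Matrix (Fin n) (Fin n) ℝ
  B₁ : ℝ≥0 → Fin d → Matrix (Fin n) (Fin m) ℝ
  B₂ : ℝ≥0 → Fin d → Matrix (Fin n) (Fin k) ℝ
  b : ℝ≥0 → Fin d → Fin n → ℝ
  C : ℝ≥0 → Fin d → Matrix (Fin n) (Fin n) ℝ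
  D₁ : ℝ≥0 → Fin d → Matrix (Fin n) (Fin m) ℝ
  D₂ : ℝ≥0 → Fin d → Matrix (Fin n) (Fin k) ℝ
  σ : ℝ≥0 → Fin d → Fin n → ℝ
  Cbar : ℝ≥0 → Fin d → Matrix (Fin n) (Fin n) ℝ
  D₁bar : ℝ≥0 → Fin d → Matrix (Fin n) (Fin m) ℝ
  D₂bar : ℝ≥0 → Fin d → Matrix (Fin n) (Fin k) ℝ
  σbar : ℝ≥0 → Fin d → Fin n → ℝ
  Q : ℝ≥0 → Fin d → Matrix (Fin n) (Fin n) ℝ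
  R₁ : ℝ≥0 → Fin d → Matrix (Fin m) (Fin m) ℝ
  R₂ : ℝ≥0 → Fin d → Matrix (Fin k) (Fin k) ℝ
  S₁ : ℝ≥0 → Fin d → Matrix (Fin m) (Fin n) ℝ
  S₂ : ℝ≥0 → Fin d → Matrix (Fin k) (Fin n) ℝ
  q : ℝ≥0 → Fin d → Fin n → ℝ
  ρ₁ : ℝ≥0 → Fin d → Fin m → ℝ
  ρ₂ : ℝ≥0 → Fin d → Fin k → ℝ
  G : Fin d → Matrix (Fin n) (Fin n) ℝ
  g : Fin d → Fin n → ℝ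

/-- Matrix-valued `Lᵖ(0,T)`, stated entry by entry. -/
def MatLp (T : ℝ≥0) (p : ℝ≥0∞) {a b : Type*} (M : ℝ≥0 → Matrix a b ℝ) : Prop :=
  ∀ i j, MemLp (fun s => M s i j) p (leb.restrict (Icc 0 T))

/-- Vector-valued `Lᵖ(0,T)`, stated entry by entry. -/
def VecLp (T : ℝ≥0) (p : ℝ≥0∞) {a : Type*} (z : ℝ≥0 → a → ℝ) : Prop :=
  ∀ i, MemLp (fun s => z s i) p (leb.restrict (Icc 0 T))

namespace Coeffs

variable {n m k d : ℕ}

/-- The block matrix `diag (R₁, R₂)`. -/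
def R (c : Coeffs n m k d) (s : ℝ≥0) (j : Fin d) : Matrix (Fin m ⊕ Fin k) (Fin m ⊕ Fin k) ℝ :=
  Matrix.fromBlocks (c.R₁ s j) 0 0 (c.R₂ s j)

/-- The block column of `S₁` and `S₂`. -/
def S (c : Coeffs n m k d) (s : ℝ≥0) (j : Fin d) : Matrix (Fin m ⊕ Fin k) (Fin n) ℝ :=
  Matrix.fromRows (c.S₁ s j) (c.S₂ s j)

/-- Integrability of the coefficients of the state equation. -/
structure H1 (c : Coeffs n m k d) (T : ℝ≥0) : Prop where
  A : ∀ j, MatLp T 1 fun s => c.A s j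
  B₁ : ∀ j, MatLp T 2 fun s => c.B₁ s j
  B₂ : ∀ j, MatLp T 2 fun s => c.B₂ s j
  b : ∀ j, VecLp T 1 fun s => c.b s j
  C : ∀ j, MatLp T 2 fun s => c.C s j
  D₁ : ∀ j, MatLp T ∞ fun s => c.D₁ s j
  D₂ : ∀ j, MatLp T ∞ fun s => c.D₂ s j
  σ : ∀ j, VecLp T 2 fun s => c.σ s j
  Cbar : ∀ j, MatLp T 2 fun s => c.Cbar s j
  D₁bar : ∀ j, MatLp T ∞ fun s => c.D₁bar s j
  D₂bar : ∀ j, MatLp T ∞ fun s => c.D₂bar s j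
  σbar : ∀ j, VecLp T 2 fun s => c.σbar s j

/-- Integrability and symmetry of the weights of the cost functional. -/
structure H2 (c : Coeffs n m k d) (T : ℝ≥0) : Prop where
  Q : ∀ j, MatLp T 1 fun s => c.Q s j
  Q_symm : ∀ j, ∀ᵐ s ∂(leb.restrict (Icc 0 T)), (c.Q s j).IsSymm
  S : ∀ j, MatLp T 2 fun s => c.S s j
  R : ∀ j, MatLp T ∞ fun s => c.R s j
  R_symm : ∀ j, ∀ᵐ s ∂(leb.restrict (Icc 0 T)), (c.R s j).IsSymm
  q : ∀ j, VecLp T 1 fun s => c.q s j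
  ρ₁ : ∀ j, VecLp T 2 fun s => c.ρ₁ s j
  ρ₂ : ∀ j, VecLp T 2 fun s => c.ρ₂ s j
  G_symm : ∀ j, (c.G j).IsSymm

/-- The definiteness conditions. -/
structure H3 (c : Coeffs n m k d) (T : ℝ≥0) : Prop where
  G : ∀ j, (c.G j).PosSemidef
  R : ∀ j, ∀ᵐ s ∂(leb.restrict (Icc 0 T)),
    ∃ δ : ℝ, 0 < δ ∧ (c.R s j - δ • (1 : Matrix (Fin m ⊕ Fin k) (Fin m ⊕ Fin k) ℝ)).PosSemidef
  Q : ∀ j, ∀ᵐ s ∂(leb.restrict (Icc 0 T)),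
    (c.Q s j - (c.S s j)ᵀ * (c.R s j)⁻¹ * c.S s j).PosSemidef

/-- The homogeneous problem: all non-homogeneous terms are set to zero. -/
def homogeneous (c : Coeffs n m k d) : Coeffs n m k d :=
  { c with b := 0, σ := 0, σbar := 0, q := 0, ρ₁ := 0, ρ₂ := 0, g := 0 }

end Coeffs

section Game

variable {Ω : Type*} [mΩ : MeasurableSpace Ω] {P : Measure Ω} {n m k d : ℕ}

/-- `x` is a strong solution on `[t,T]` of
`dx = [A x + B₁ u + B₂ v + b] ds + [C x + D₁ u + D₂ v + σ] dW + [C̄ x + D̄₁ u + D̄₂ v + σ̄] dW̄`,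
`x(t) = ξ`, where the coefficients are taken at `(s, α(s))`, and
`x` belongs to the space `L²_𝔽(Ω; C([t,T];ℝⁿ))`. -/
structure IsSolution (𝔹 : Basis P d) (c : Coeffs n m k d) (t T : ℝ≥0) (ξ : Ω → Fin n → ℝ)
    (u : ℝ≥0 → Ω → Fin m → ℝ) (v : ℝ≥0 → Ω → Fin k → ℝ) (x : ℝ≥0 → Ω → Fin n → ℝ) : Prop where
  adapted : ∀ s ∈ Icc t T, Measurable[𝔹.F s] (x s)
  continuousOn : ∀ ω, ContinuousOn (fun s => x s ω) (Icc t T)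
  sq_integrable : ∫⁻ ω, ⨆ s ∈ Icc t T, ENNReal.ofReal (x s ω ⬝ᵥ x s ω) ∂P < ∞
  equation : ∃ M Mbar : Fin n → ℝ≥0 → Ω → ℝ,
    (∀ a, IsItoIntegral P 𝔹.F 𝔹.W t T
      (fun s ω => (c.C s (𝔹.α s ω) *ᵥ x s ω + c.D₁ s (𝔹.α s ω) *ᵥ u s ω
        + c.D₂ s (𝔹.α s ω) *ᵥ v s ω + c.σ s (𝔹.α s ω)) a) (M a)) ∧
    (∀ a, IsItoIntegral P 𝔹.F 𝔹.Wbar t T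
      (fun s ω => (c.Cbar s (𝔹.α s ω) *ᵥ x s ω + c.D₁bar s (𝔹.α s ω) *ᵥ u s ω
        + c.D₂bar s (𝔹.α s ω) *ᵥ v s ω + c.σbar s (𝔹.α s ω)) a) (Mbar a)) ∧
    ∀ᵐ ω ∂P, ∀ s ∈ Icc t T, ∀ a,
      x s ω a = ξ ω a
        + (∫ r in Icc t s, (c.A r (𝔹.α r ω) *ᵥ x r ω + c.B₁ r (𝔹.α r ω) *ᵥ u r ω
            + c.B₂ r (𝔹.α r ω) *ᵥ v r ω + c.b r (𝔹.α r ω)) a ∂leb)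
        + M a s ω + Mbar a s ω

open Classical in
/-- The state process `x(·; t, ξ, u, v)`: the strong solution of the state equation. Under `H1`,
for square-integrable `ξ`, `u`, `v`, it exists and is unique up to indistinguishability; by
convention the value is `0` if there is no solution. -/
def state (𝔹 : Basis P d) (c : Coeffs n m k d) (t T : ℝ≥0) (ξ : Ω → Fin n → ℝ)
    (u : ℝ≥0 → Ω → Fin m → ℝ) (v : ℝ≥0 → Ω → Fin k → ℝ) : ℝ≥0 → Ω → Fin n → ℝ :=
  if h : ∃ x, IsSolution 𝔹 c t T ξ u v x then h.choose else 0

/-- The soft-constrained cost `J_γ` as a functional of the state, control and disturbance. -/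
def costOf (𝔹 : Basis P d) (c : Coeffs n m k d) (γ : ℝ) (t T : ℝ≥0)
    (x : ℝ≥0 → Ω → Fin n → ℝ) (u : ℝ≥0 → Ω → Fin m → ℝ) (v : ℝ≥0 → Ω → Fin k → ℝ) : ℝ :=
  ∫ ω, ((c.G (𝔹.α T ω) *ᵥ x T ω) ⬝ᵥ x T ω + 2 * (c.g (𝔹.α T ω) ⬝ᵥ x T ω)
    + ∫ s in Icc t T,
      ((c.Q s (𝔹.α s ω) *ᵥ x s ω) ⬝ᵥ x s ω
        + (c.R₁ s (𝔹.α s ω) *ᵥ u s ω) ⬝ᵥ u s ω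
        + ((c.R₂ s (𝔹.α s ω) - γ ^ 2 • (1 : Matrix (Fin k) (Fin k) ℝ)) *ᵥ v s ω) ⬝ᵥ v s ω
        + 2 * ((c.S₁ s (𝔹.α s ω) *ᵥ x s ω) ⬝ᵥ u s ω)
        + 2 * ((c.S₂ s (𝔹.α s ω) *ᵥ x s ω) ⬝ᵥ v s ω)
        + 2 * (c.q s (𝔹.α s ω) ⬝ᵥ x s ω)
        + 2 * (c.ρ₁ s (𝔹.α s ω) ⬝ᵥ u s ω)
        + 2 * (c.ρ₂ s (𝔹.α s ω) ⬝ᵥ v s ω)) ∂leb) ∂P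

/-- `J_γ(t, ξ; u, v)`. -/
def Jγ (𝔹 : Basis P d) (c : Coeffs n m k d) (γ : ℝ) (t T : ℝ≥0) (ξ : Ω → Fin n → ℝ)
    (u : ℝ≥0 → Ω → Fin m → ℝ) (v : ℝ≥0 → Ω → Fin k → ℝ) : ℝ :=
  costOf 𝔹 c γ t T (state 𝔹 c t T ξ u v) u v

/-- The open-loop upper value of the homogeneous problem,
`inf_{u ∈ L²_𝔾(t,T;ℝᵐ)} sup_{v ∈ L²_𝔽(t,T;ℝᵏ)} J⁰_γ(t, ξ; u, v)`, with values in `[-∞, ∞]`.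
The initial regime is `α(t)`. -/
def upperValue (𝔹 : Basis P d) (c : Coeffs n m k d) (γ : ℝ) (t T : ℝ≥0) (ξ : Ω → Fin n → ℝ) :
    EReal :=
  ⨅ u ∈ L2Prog P 𝔹.G t T m, ⨆ v ∈ L2Prog P 𝔹.F t T k,
    ((Jγ 𝔹 c.homogeneous γ t T ξ u v : ℝ) : EReal)

/-- The set of `γ > 0` such that the upper value at zero initial time and state vanishes for all
`γ' > γ`. -/
def barGammaSet (𝔹 : Basis P d) (c : Coeffs n m k d) (T : ℝ≥0) : Set ℝ :=
  {γ | 0 < γ ∧ ∀ γ' : ℝ, γ < γ' → upperValue 𝔹 c γ' 0 T 0 = 0}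

/-- The threshold: the infimum of `barGammaSet` (equal to `+∞` if the set is empty). -/
def barGamma (𝔹 : Basis P d) (c : Coeffs n m k d) (T : ℝ≥0) : EReal :=
  ⨅ γ ∈ barGammaSet 𝔹 c T, ((γ : ℝ) : EReal)

end Game

end RegimeLQ

end

/-!
The claim is that the vanishing of the upper value at `γ` forces it to vanish at every `γ' > γ`;
then `γ` itself lies in `barGammaSet` and bounds its infimum.

*Upper bound.* Raising `γ` only subtracts `(γ'² - γ²) ∫ |v|²` from the cost of a pair `(u, v)`, and
the state does not depend on `γ`, so the upper value is antitone in `γ`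
(`upperValue_antitone`). For almost every `ω` the running cost is integrable in time: the path
`x` is continuous, hence bounded on `[0,T]`, the paths of `u` and `v` are square integrable, and
the coefficients satisfy the Hölder bounds of `Coeffs.H2` (`ae_integrable_runningCost`).

*Lower bound.* With the disturbance `v = 0` the parameter `γ` disappears from the cost, and the
Schur complement condition in `Coeffs.H3` makes both the terminal and the running cost nonnegative
(`quadratic_nonneg`), so the upper value is nonnegative for every `γ` (`upperValue_nonneg`).
-/

noncomputable section

namespace RegimeLQ

/-! ### Integrability along paths -/

theorem measurableEmbedding_coe_nnreal : MeasurableEmbedding ((↑) : ℝ≥0 → ℝ) :=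
  MeasurableEmbedding.subtype_coe measurableSet_Ici

instance isFiniteMeasureOnCompacts_leb : IsFiniteMeasureOnCompacts leb :=
  .comap' _ NNReal.continuous_coe measurableEmbedding_coe_nnreal

instance isFiniteMeasure_leb_restrict_Icc (t T : ℝ≥0) :
    IsFiniteMeasure (leb.restrict (Icc t T)) :=
  isFiniteMeasure_restrict.2 isCompact_Icc.measure_lt_top.ne

variable {Ω : Type*} [mΩ : MeasurableSpace Ω] {P : Measure Ω} {n m k d : ℕ}

/-- Each level set of a path of the chain is Borel, because a right-continuous path with values in
a discrete space stays in a level set for some time to the right of every point of it. -/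
theorem Basis.measurableSet_regime (𝔹 : Basis P d) (ω : Ω) (j : Fin d) :
    MeasurableSet {s | 𝔹.α s ω = j} :=
  MeasurableSet.of_mem_nhdsGT fun s hs => by
    filter_upwards [𝔹.rightCont ω s] with r hr
    exact hr.trans hs

/-- A finite family of matrix functions in `Lᵖ` stays in `Lᵖ` when the index follows a path of the
chain. -/
theorem Basis.matLp_regime (𝔹 : Basis P d) {T : ℝ≥0} {p : ℝ≥0∞} {a b : Type*}
    {M : ℝ≥0 → Fin d → Matrix a b ℝ} (hM : ∀ j, MatLp T p fun s => M s j) (ω : Ω) :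
    MatLp T p fun s => M s (𝔹.α s ω) := by
  intro i l
  have h : (fun s => M s (𝔹.α s ω) i l)
      = fun s => ∑ j, {s | 𝔹.α s ω = j}.indicator (fun s => M s j i l) s := by
    funext s
    simp [Set.indicator_apply]
  show MemLp (fun s => M s (𝔹.α s ω) i l) p _
  rw [h]
  exact memLp_finsetSum _ fun j _ => (hM j i l).indicator (𝔹.measurableSet_regime ω j)

/-- Hölder's inequality for a bilinear form along a path; the exponents used are `(1, ∞, ∞)`,
`(∞, 2, 2)` and `(2, ∞, 2)` for the weights `Q`, `R` and `S`. -/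
theorem integrable_bilin {T : ℝ≥0} {p q q' r : ℝ≥0∞} [ENNReal.HolderTriple p q r]
    [ENNReal.HolderTriple r q' 1] {a b : ℕ} {M : ℝ≥0 → Matrix (Fin a) (Fin b) ℝ}
    {y : ℝ≥0 → Fin b → ℝ} {z : ℝ≥0 → Fin a → ℝ} (hM : MatLp T p M) (hy : VecLp T q y)
    (hz : VecLp T q' z) :
    Integrable (fun s => (M s *ᵥ y s) ⬝ᵥ z s) (leb.restrict (Icc 0 T)) := by
  simp only [dotProduct, Matrix.mulVec]
  refine integrable_finsetSum _ fun i _ => ?_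
  rw [← memLp_one_iff_integrable]
  have h : MemLp (fun s => ∑ l, M s i l * y s l) r (leb.restrict (Icc 0 T)) :=
    memLp_finsetSum _ fun l _ => (hy l).mul' (hM i l)
  exact (hz i).mul' h

theorem vecLp_top_of_continuousOn {T : ℝ≥0} {a : ℕ} {y : ℝ≥0 → Fin a → ℝ}
    (hy : ContinuousOn y (Icc 0 T)) : VecLp T ∞ y := by
  intro i
  have hc : ContinuousOn (fun s => y s i) (Icc 0 T) :=
    (continuous_apply i).comp_continuousOn hy
  obtain ⟨K, hK⟩ := isCompact_Icc.exists_bound_of_continuousOn hc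
  exact memLp_top_of_bound (hc.aestronglyMeasurable measurableSet_Icc) K
    ((ae_restrict_iff' measurableSet_Icc).2 (ae_of_all _ hK))

/-- Stopping the time argument at `T` turns progressive measurability on `[0,T]` into joint
measurability on the whole time axis. -/
theorem measurable_stopped {H : Filtration ℝ≥0 mΩ} {φ : ℝ≥0 → Ω → Fin k → ℝ}
    (hφ : IsProgressive H φ) (T : ℝ≥0) :
    Measurable fun p : Ω × ℝ≥0 => φ (min p.2 T) p.1 := by
  have h : Measurable fun p : Iic T × Ω => φ p.1 p.2 :=
    (hφ T).mono (sup_le_sup le_rfl (MeasurableSpace.comap_mono (H.le T))) le_rfl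
  exact h.comp (g := fun p : Iic T × Ω => φ p.1 p.2)
    (f := fun p : Ω × ℝ≥0 => ((⟨min p.2 T, mem_Iic.2 (min_le_right _ _)⟩ : Iic T), p.1))
    (((measurable_snd.min measurable_const).subtype_mk).prodMk measurable_fst)

theorem ae_min_eq (T : ℝ≥0) : ∀ᵐ s ∂(leb.restrict (Icc 0 T)), min s T = s :=
  (ae_restrict_iff' measurableSet_Icc).2 (ae_of_all _ fun _ hs => min_eq_left hs.2)

theorem integrable_prod_sq [SFinite P] {H : Filtration ℝ≥0 mΩ} {T : ℝ≥0}
    {φ : ℝ≥0 → Ω → Fin k → ℝ} (hφ : φ ∈ L2Prog P H 0 T k) :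
    Integrable (fun p : Ω × ℝ≥0 => φ (min p.2 T) p.1 ⬝ᵥ φ (min p.2 T) p.1)
      (P.prod (leb.restrict (Icc 0 T))) := by
  have hm := measurable_stopped hφ.1 T
  have hm2 : Measurable fun p : Ω × ℝ≥0 => φ (min p.2 T) p.1 ⬝ᵥ φ (min p.2 T) p.1 := by
    have hc (i : Fin k) : Measurable fun p : Ω × ℝ≥0 => φ (min p.2 T) p.1 i :=
      (measurable_pi_apply i).comp hm
    exact Finset.measurable_sum _ fun i _ => (hc i).mul (hc i)
  refine ⟨hm2.aestronglyMeasurable, ?_⟩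
  rw [hasFiniteIntegral_iff_ofReal
    (ae_of_all _ fun p => by simpa using dotProduct_star_self_nonneg (φ (min p.2 T) p.1)),
    lintegral_prod _ hm2.ennreal_ofReal.aemeasurable]
  refine lt_of_eq_of_lt (lintegral_congr fun ω => lintegral_congr_ae ?_) hφ.2
  filter_upwards [ae_min_eq T] with s hs
  simp only [hs]

/-- The energy `ω ↦ ∫_0^T |φ(s, ω)|² ds` of a process in `L²(0,T)` is an integrable random
variable. -/
theorem integrable_energy [SFinite P] {H : Filtration ℝ≥0 mΩ} {T : ℝ≥0}
    {φ : ℝ≥0 → Ω → Fin k → ℝ} (hφ : φ ∈ L2Prog P H 0 T k) :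
    Integrable (fun ω => ∫ s in Icc 0 T, φ s ω ⬝ᵥ φ s ω ∂leb) P := by
  refine (integrable_prod_sq hφ).integral_prod_left.congr (ae_of_all _ fun ω => ?_)
  refine integral_congr_ae ?_
  filter_upwards [ae_min_eq T] with s hs
  simp only [hs]

theorem ae_path_vecLp [SFinite P] {H : Filtration ℝ≥0 mΩ} {T : ℝ≥0}
    {φ : ℝ≥0 → Ω → Fin k → ℝ} (hφ : φ ∈ L2Prog P H 0 T k) :
    ∀ᵐ ω ∂P, VecLp T 2 fun s => φ s ω := by
  have hm := measurable_stopped hφ.1 T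
  filter_upwards [(integrable_prod_sq hφ).prod_right_ae] with ω hω i
  have hi : Measurable fun s : ℝ≥0 => φ (min s T) ω i :=
    (measurable_pi_apply i).comp (hm.comp measurable_prodMk_left)
  have h2 : MemLp (fun s : ℝ≥0 => φ (min s T) ω i) 2 (leb.restrict (Icc 0 T)) := by
    rw [memLp_two_iff_integrable_sq hi.aestronglyMeasurable]
    refine hω.mono' (hi.pow_const 2).aestronglyMeasurable (ae_of_all _ fun s => ?_)
    rw [Real.norm_of_nonneg (sq_nonneg _), sq]
    exact Finset.single_le_sum (f := fun l => φ (min s T) ω l * φ (min s T) ω l)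
      (fun l _ => mul_self_nonneg _) (Finset.mem_univ i)
  refine (memLp_congr_ae ?_).1 h2
  filter_upwards [ae_min_eq T] with s hs
  simp only [hs]

/-! ### The cost is antitone in `γ` -/

/-- The running cost of the homogeneous problem, as a function of the current regime `j`, state
`x`, control `u` and disturbance `v`. -/
def Coeffs.runningCost (c : Coeffs n m k d) (γ : ℝ) (s : ℝ≥0) (j : Fin d) (x : Fin n → ℝ)
    (u : Fin m → ℝ) (v : Fin k → ℝ) : ℝ :=
  (c.Q s j *ᵥ x) ⬝ᵥ x + (c.R₁ s j *ᵥ u) ⬝ᵥ u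
    + ((c.R₂ s j - γ ^ 2 • (1 : Matrix (Fin k) (Fin k) ℝ)) *ᵥ v) ⬝ᵥ v
    + 2 * ((c.S₁ s j *ᵥ x) ⬝ᵥ u) + 2 * ((c.S₂ s j *ᵥ x) ⬝ᵥ v)

theorem costOf_homogeneous (𝔹 : Basis P d) (c : Coeffs n m k d) (γ : ℝ) (T : ℝ≥0)
    (x : ℝ≥0 → Ω → Fin n → ℝ) (u : ℝ≥0 → Ω → Fin m → ℝ) (v : ℝ≥0 → Ω → Fin k → ℝ) :
    costOf 𝔹 c.homogeneous γ 0 T x u v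
      = ∫ ω, ((c.G (𝔹.α T ω) *ᵥ x T ω) ⬝ᵥ x T ω
        + ∫ s in Icc 0 T, c.runningCost γ s (𝔹.α s ω) (x s ω) (u s ω) (v s ω) ∂leb) ∂P := by
  simp [costOf, Coeffs.homogeneous, Coeffs.runningCost]

theorem Coeffs.runningCost_eq (c : Coeffs n m k d) (γ : ℝ) (s : ℝ≥0) (j : Fin d)
    (x : Fin n → ℝ) (u : Fin m → ℝ) (v : Fin k → ℝ) :
    c.runningCost γ s j x u v = c.runningCost 0 s j x u v - γ ^ 2 * (v ⬝ᵥ v) := by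
  simp only [runningCost, Matrix.sub_mulVec, Matrix.smul_mulVec, Matrix.one_mulVec,
    sub_dotProduct, smul_dotProduct, smul_eq_mul]
  ring

theorem ae_integrable_runningCost [SFinite P] {H K : Filtration ℝ≥0 mΩ} {T : ℝ≥0} (𝔹 : Basis P d)
    {c : Coeffs n m k d} (h2 : c.H2 T) {x : ℝ≥0 → Ω → Fin n → ℝ} {u : ℝ≥0 → Ω → Fin m → ℝ}
    {v : ℝ≥0 → Ω → Fin k → ℝ} (hx : ∀ ω, ContinuousOn (fun s => x s ω) (Icc 0 T))
    (hu : u ∈ L2Prog P H 0 T m) (hv : v ∈ L2Prog P K 0 T k) :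
    ∀ᵐ ω ∂P, Integrable
        (fun s => c.runningCost 0 s (𝔹.α s ω) (x s ω) (u s ω) (v s ω)) (leb.restrict (Icc 0 T)) ∧
      Integrable (fun s => v s ω ⬝ᵥ v s ω) (leb.restrict (Icc 0 T)) := by
  have hR₁ : ∀ j, MatLp T ∞ fun s => c.R₁ s j := fun j a b => h2.R j (.inl a) (.inl b)
  have hR₂ : ∀ j, MatLp T ∞ fun s => c.R₂ s j := fun j a b => h2.R j (.inr a) (.inr b)
  have hS₁ : ∀ j, MatLp T 2 fun s => c.S₁ s j := fun j a b => h2.S j (.inl a) b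
  have hS₂ : ∀ j, MatLp T 2 fun s => c.S₂ s j := fun j a b => h2.S j (.inr a) b
  filter_upwards [ae_path_vecLp hu, ae_path_vecLp hv] with ω hu' hv'
  have hx' := vecLp_top_of_continuousOn (hx ω)
  constructor
  · simp only [Coeffs.runningCost, ne_eq, OfNat.ofNat_ne_zero, not_false_eq_true, zero_pow,
      zero_smul, sub_zero]
    exact ((((integrable_bilin (r := 1) (𝔹.matLp_regime h2.Q ω) hx' hx').add
      (integrable_bilin (r := 2) (𝔹.matLp_regime hR₁ ω) hu' hu')).add
      (integrable_bilin (r := 2) (𝔹.matLp_regime hR₂ ω) hv' hv')).add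
      ((integrable_bilin (r := 2) (𝔹.matLp_regime hS₁ ω) hx' hu').const_mul 2)).add
      ((integrable_bilin (r := 2) (𝔹.matLp_regime hS₂ ω) hx' hv').const_mul 2)
  · simp only [dotProduct]
    refine integrable_finsetSum _ fun i _ => ?_
    rw [← memLp_one_iff_integrable]
    exact (hv' i).mul' (hv' i)

/-- A larger `γ` lowers the cost of a fixed triple `(x, u, v)`, by a multiple of `E ∫ |v|² ds`. -/
theorem costOf_antitone [SFinite P] {H K : Filtration ℝ≥0 mΩ} {T : ℝ≥0} (𝔹 : Basis P d)
    {c : Coeffs n m k d} (h2 : c.H2 T) {x : ℝ≥0 → Ω → Fin n → ℝ} {u : ℝ≥0 → Ω → Fin m → ℝ}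
    {v : ℝ≥0 → Ω → Fin k → ℝ} (hx : ∀ ω, ContinuousOn (fun s => x s ω) (Icc 0 T))
    (hu : u ∈ L2Prog P H 0 T m) (hv : v ∈ L2Prog P K 0 T k) {γ γ' : ℝ} (hγ : 0 ≤ γ)
    (hγγ' : γ ≤ γ') :
    costOf 𝔹 c.homogeneous γ' 0 T x u v ≤ costOf 𝔹 c.homogeneous γ 0 T x u v := by
  have hE := integrable_energy hv
  set E : Ω → ℝ := fun ω => ∫ s in Icc 0 T, v s ω ⬝ᵥ v s ω ∂leb
  have hE0 : 0 ≤ E := fun ω =>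
    integral_nonneg fun s => by simpa using dotProduct_star_self_nonneg (v s ω)
  set f : Ω → ℝ := fun ω => (c.G (𝔹.α T ω) *ᵥ x T ω) ⬝ᵥ x T ω
    + ∫ s in Icc 0 T, c.runningCost 0 s (𝔹.α s ω) (x s ω) (u s ω) (v s ω) ∂leb
  have key : ∀ η : ℝ, costOf 𝔹 c.homogeneous η 0 T x u v = ∫ ω, (f ω + -(η ^ 2 * E ω)) ∂P := by
    intro η
    rw [costOf_homogeneous]
    refine integral_congr_ae ?_
    filter_upwards [ae_integrable_runningCost 𝔹 h2 hx hu hv] with ω hω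
    simp only [c.runningCost_eq η]
    rw [integral_sub hω.1 (hω.2.const_mul _), integral_const_mul]
    simp only [f, E]
    ring
  have hint : ∀ η : ℝ, Integrable (fun ω => -(η ^ 2 * E ω)) P := fun η => (hE.const_mul _).neg
  rw [key, key]
  by_cases hf : Integrable f P
  · refine integral_mono (hf.add (hint γ')) (hf.add (hint γ)) fun ω => ?_
    have : γ ^ 2 * E ω ≤ γ' ^ 2 * E ω :=
      mul_le_mul_of_nonneg_right (pow_le_pow_left₀ hγ hγγ' 2) (hE0 ω)
    linarith
  -- The two integrands differ from `f` by integrable functions, so neither is integrable here.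
  · rw [integral_undef fun h => hf ((integrable_add_iff_integrable_left' (hint γ')).1 h),
      integral_undef fun h => hf ((integrable_add_iff_integrable_left' (hint γ)).1 h)]

/-- The path of the state is continuous, also under the convention that the state is `0` when the
equation has no solution. -/
theorem continuousOn_state (𝔹 : Basis P d) (c : Coeffs n m k d) (t T : ℝ≥0) (ξ : Ω → Fin n → ℝ)
    (u : ℝ≥0 → Ω → Fin m → ℝ) (v : ℝ≥0 → Ω → Fin k → ℝ) (ω : Ω) :
    ContinuousOn (fun s => state 𝔹 c t T ξ u v s ω) (Icc t T) := by
  unfold state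
  split_ifs with h
  · exact h.choose_spec.continuousOn ω
  · exact continuousOn_const

theorem upperValue_antitone [SFinite P] {T : ℝ≥0} (𝔹 : Basis P d) {c : Coeffs n m k d}
    (h2 : c.H2 T) (ξ : Ω → Fin n → ℝ) {γ γ' : ℝ} (hγ : 0 ≤ γ) (hγγ' : γ ≤ γ') :
    upperValue 𝔹 c γ' 0 T ξ ≤ upperValue 𝔹 c γ 0 T ξ :=
  iInf₂_mono fun _ hu => iSup₂_mono fun _ hv => EReal.coe_le_coe_iff.2
    (costOf_antitone 𝔹 h2 (continuousOn_state _ _ _ _ _ _ _) hu hv hγ hγγ')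

/-! ### The upper value is nonnegative -/

/-- The right side is the form of the block matrix `(R, S; Sᵀ, Q)`, whose Schur complement with
respect to `R` is assumed positive semidefinite. -/
theorem quadratic_nonneg {ι κ : Type*} [Fintype ι] [DecidableEq ι] [Fintype κ]
    {R : Matrix ι ι ℝ} {S : Matrix ι κ ℝ} {Q : Matrix κ κ ℝ} (hR : R.PosDef)
    (hQ : (Q - Sᵀ * R⁻¹ * S).PosSemidef) (z : ι → ℝ) (x : κ → ℝ) :
    0 ≤ (Q *ᵥ x) ⬝ᵥ x + (R *ᵥ z) ⬝ᵥ z + 2 * ((S *ᵥ x) ⬝ᵥ z) := by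
  have : Invertible R := hR.isUnit.invertible
  have h := ((Matrix.PosDef.fromBlocks₁₁ S Q hR).2
    (by rwa [Matrix.conjTranspose_eq_transpose_of_trivial])).dotProduct_mulVec_nonneg
    (Sum.elim z x)
  have hS : x ⬝ᵥ (Sᵀ *ᵥ z) = (S *ᵥ x) ⬝ᵥ z := by
    rw [Matrix.dotProduct_mulVec, Matrix.vecMul_transpose]
  simp only [Matrix.conjTranspose_eq_transpose_of_trivial, Matrix.fromBlocks_mulVec,
    Sum.elim_comp_inl, Sum.elim_comp_inr, star_trivial, sumElim_dotProduct_sumElim,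
    dotProduct_add, hS] at h
  rw [dotProduct_comm z (S *ᵥ x), dotProduct_comm z, dotProduct_comm x] at h
  linarith

theorem Coeffs.H3.ae_runningCost_nonneg {c : Coeffs n m k d} {T : ℝ≥0} (h3 : c.H3 T) (γ : ℝ) :
    ∀ᵐ s ∂(leb.restrict (Icc 0 T)), ∀ j x u, 0 ≤ c.runningCost γ s j x u 0 := by
  filter_upwards [ae_all_iff.2 h3.R, ae_all_iff.2 h3.Q] with s hR hQ j x u
  obtain ⟨δ, hδ, hRδ⟩ := hR j
  have hpd : (c.R s j).PosDef := by
    have h := Matrix.PosDef.posSemidef_add hRδ (Matrix.PosDef.one.smul hδ)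
    rwa [sub_add_cancel] at h
  have h := quadratic_nonneg hpd (hQ j) (Sum.elim u 0) x
  simpa [Coeffs.R, Coeffs.S, Coeffs.runningCost, Matrix.fromBlocks_mulVec,
    Matrix.fromRows_mulVec, sumElim_dotProduct_sumElim] using h

theorem costOf_zero_disturbance_nonneg (𝔹 : Basis P d) {c : Coeffs n m k d} {T : ℝ≥0}
    (h3 : c.H3 T) (γ : ℝ) (x : ℝ≥0 → Ω → Fin n → ℝ) (u : ℝ≥0 → Ω → Fin m → ℝ) :
    0 ≤ costOf 𝔹 c.homogeneous γ 0 T x u 0 := by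
  rw [costOf_homogeneous]
  refine integral_nonneg fun ω => add_nonneg ?_ (integral_nonneg_of_ae ?_)
  · rw [dotProduct_comm]
    simpa using (h3.G (𝔹.α T ω)).dotProduct_mulVec_nonneg (x T ω)
  · filter_upwards [h3.ae_runningCost_nonneg γ] with s hs
    exact hs _ _ _

theorem zero_mem_L2Prog (H : Filtration ℝ≥0 mΩ) (t T : ℝ≥0) :
    (0 : ℝ≥0 → Ω → Fin k → ℝ) ∈ L2Prog P H t T k :=
  ⟨isProgressive_const H 0, by simp⟩

theorem upperValue_nonneg {T : ℝ≥0} (𝔹 : Basis P d) {c : Coeffs n m k d} (h3 : c.H3 T)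
    (ξ : Ω → Fin n → ℝ) (γ : ℝ) : 0 ≤ upperValue 𝔹 c γ 0 T ξ :=
  le_iInf₂ fun u _ => le_iSup₂_of_le 0 (zero_mem_L2Prog _ _ _)
    (EReal.coe_nonneg.2 (costOf_zero_disturbance_nonneg 𝔹 h3 γ _ u))

end RegimeLQ

end

theorem corollary3p1 {Ω : Type*} [MeasurableSpace Ω] (P : Measure Ω) [IsProbabilityMeasure P]
    [P.IsComplete] {n m k d : ℕ} (T : ℝ≥0) (hT : 0 < T)
    (𝔹 : RegimeLQ.Basis P d) (i : Fin d) (hi : ∀ᵐ ω ∂P, 𝔹.α 0 ω = i)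
    (c : RegimeLQ.Coeffs n m k d) (h1 : c.H1 T) (h2 : c.H2 T) (h3 : c.H3 T)
    (γ : ℝ) (hγ : 0 < γ) (hV : RegimeLQ.upperValue 𝔹 c γ 0 T 0 = 0) :
    RegimeLQ.barGamma 𝔹 c T ≤ (γ : EReal) := by
  refine iInf₂_le γ ⟨hγ, fun γ' hγγ' => le_antisymm ?_ ?_⟩
  · exact (RegimeLQ.upperValue_antitone 𝔹 h2 0 hγ.le hγγ'.le).trans hV.le
  · exact RegimeLQ.upperValue_nonneg 𝔹 h3 0 γ'
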